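/- Let $I$ be a finite set and let $\Delta$ be a right-angled building of type $M=(m_{ij})_{i,j\in I}$ (so $m_{ij}\in\{2,\infty\}$ for all $i\neq j$), viewed as a chamber system, whose Coxeter diagram has no isolated nodes: for every $i\in I$ there is $j\in I$ with $m_{ij}=\infty$. For each $i\in I$ let $X_i$ be a set and let $F_i\leq\mathrm{Sym}(X_i)$ be a permutation group (not necessarily transitive, closed, or of finite degree). Assume that $\Delta$ is semiregular with parameters $(|X_i|)_{i\in I}$, i.e. every $i$-panel has cardinality $|X_i|$ (necessarily $|X_i|\geq 2$), and let $\lambda=(\lambda_i)_{i\in I}\colon\Delta\to\prod_{i\in I}X_i$ be a legal colouring: for every $i$-panel $\mathcal P$, the restriction $\lambda_i|_{\mathcal P}\colon\mathcal P\to X_i$ is a bijection, and $\lambda_j|_{\mathcal P}$ is constant for every $j\neq i$. Let $$U(\boldsymbol F)=\{g\in\mathrm{Aut}(\Delta)\mid \lambda_i|_{g\mathcal P}\circ g|_{\mathcal P}\circ(\lambda_i|_{\mathcal P})^{-1}\in F_i\text{ for every } i\in I\text{ and every } i\text{-panel }\mathcal P\}$$ be the universal group, where $\mathrm{Aut}(\Delta)$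 is the group of type-preserving automorphisms. Endow $\mathrm{Aut}(\Delta)$ and its subgroups with the permutation topology, in which the pointwise stabilisers of finite sets of chambers form a neighbourhood basis of the identity. Assume that $U(\boldsymbol F)$ is closed in $\mathrm{Aut}(\Delta)$, locally compact, and compactly generated (i.e. generated as a group by a compact subset). Then for every $i\in I$ the local group $F_i$ has only finitely many orbits on $X_i$. -/

import Mathlib

/-- The permutation topology on `Sym(X)`: a set is open when it contains, with each element `g`, the
coset `g · Sym(X)_(Φ)` of the pointwise stabiliser of some finite set `Φ ⊆ X`. Subgroups of
`Sym(X)` carry the subspace topology, which is their own permutation topology. -/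
instance permTopology (X : Type*) : TopologicalSpace (Equiv.Perm X) where
  IsOpen U := ∀ g ∈ U, ∃ Φ : Finset X, ∀ h : Equiv.Perm X, (∀ x ∈ Φ, h x = x) → g * h ∈ U
  isOpen_univ := fun _ _ => ⟨∅, fun _ _ => Set.mem_univ _⟩
  isOpen_inter := by
    classical
    intro U V hU hV g hg
    obtain ⟨Φ, hΦ⟩ := hU g hg.1
    obtain ⟨Ψ, hΨ⟩ := hV g hg.2
    exact ⟨Φ ∪ Ψ, fun h hh => ⟨hΦ h fun x hx => hh x (Finset.mem_union_left _ hx),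
      hΨ h fun x hx => hh x (Finset.mem_union_right _ hx)⟩⟩
  isOpen_sUnion := by
    intro S hS g hg
    obtain ⟨U, hU, hgU⟩ := hg
    obtain ⟨Φ, hΦ⟩ := hS U hU g hgU
    exact ⟨Φ, fun h hh => ⟨U, hU, hΦ h hh⟩⟩

/-- A topological group is compactly generated if some compact subset generates it as a group. -/
def IsCompactlyGeneratedGroup (G : Type*) [Group G] [TopologicalSpace G] : Prop :=
  ∃ K : Set G, IsCompact K ∧ Subgroup.closure K = ⊤

/-- A chamber system over `I` with set of chambers `C`: for every `i ∈ I` an equivalence relation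
on the chambers, called `i`-adjacency. -/
structure ChamberSystem (I C : Type*) where
  adj : I → Setoid C

namespace ChamberSystem

variable {I C : Type*} (Δ : ChamberSystem I C)

/-- The `i`-panel containing the chamber `c`, that is, its class under `i`-adjacency. Every
`i`-panel is of this form. -/
def panel (i : I) (c : C) : Set C := {d | (Δ.adj i).r c d}

/-- `Δ.IsGallery ω x y`: there is a gallery from `x` to `y` of type `ω`, i.e. a sequence of chambers
with consecutive ones distinct and `i`-adjacent for the respective letter `i` of `ω`. -/
def IsGallery : List I → C → C → Prop
  | [], x, y => x = y
  | i :: ω, x, y => ∃ z, z ≠ x ∧ (Δ.adj i).r x z ∧ IsGallery ω z y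

/-- `Δ` is a building of type `M`: it has at least one chamber, every panel has at least two
chambers, and there is a distance function `δ` with values in the Coxeter group `W` of type `M`
such that, for every reduced word `ω`, one has `δ x y = r_ω` if and only if `x` and `y` are joined
by a gallery of type `ω`. -/
def IsBuilding (M : CoxeterMatrix I) : Prop :=
  Nonempty C ∧ (∀ i c, ∃ d ∈ Δ.panel i c, d ≠ c) ∧
    ∃ δ : C → C → M.Group, ∀ ω : List I, M.toCoxeterSystem.IsReduced ω →
      ∀ x y : C, δ x y = M.toCoxeterSystem.wordProd ω ↔ Δ.IsGallery ω x y

/-- The group `Aut(Δ)` of (type-preserving) automorphisms of `Δ`. -/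
def aut : Subgroup (Equiv.Perm C) where
  carrier := {g | ∀ i c d, (Δ.adj i).r (g c) (g d) ↔ (Δ.adj i).r c d}
  mul_mem' := by
    intro g h hg hh i c d
    exact (hg i (h c) (h d)).trans (hh i c d)
  one_mem' := fun _ _ _ => Iff.rfl
  inv_mem' := by
    intro g hg i c d
    have := hg i (g⁻¹ c) (g⁻¹ d)
    simpa using this.symm

/-- An automorphism maps the `i`-panel of `c` bijectively onto the `i`-panel of its image. -/
def panelMap (g : Δ.aut) (i : I) (c : C) : Δ.panel i c ≃ Δ.panel i (g.1 c) :=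
  g.1.subtypeEquiv fun d => (g.2 i c d).symm

/-- A legal colouring of `Δ` with colour sets `X i`: on each `i`-panel, the `i`-th colour is a
bijection to `X i` and every other colour is constant. (In particular all `i`-panels have
cardinality `|X i|`, that is, `Δ` is semiregular with parameters `|X i|`.) -/
structure LegalColouring (X : I → Type*) where
  colour : C → (i : I) → X i
  bijective_panel : ∀ i c, Function.Bijective fun d : Δ.panel i c => colour d i
  constant_panel : ∀ i j, j ≠ i → ∀ c, ∀ d ∈ Δ.panel i c, colour d j = colour c j

namespace LegalColouring

variable {Δ} {X : I → Type*} (col : Δ.LegalColouring X)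

/-- The bijection from the `i`-panel of `c` to `X i` given by the `i`-th colour. -/
noncomputable def panelEquiv (i : I) (c : C) : Δ.panel i c ≃ X i :=
  Equiv.ofBijective (fun d => col.colour d i) (col.bijective_panel i c)

/-- The local action `σ(g, P) = λ_i|_{gP} ∘ g|_P ∘ (λ_i|_P)⁻¹` of an automorphism `g` at the
`i`-panel `P` of `c`. -/
noncomputable def localAction (g : Δ.aut) (i : I) (c : C) : Equiv.Perm (X i) :=
  ((col.panelEquiv i c).symm.trans (Δ.panelMap g i c)).trans (col.panelEquiv i (g.1 c))

theorem localAction_colour (g : Δ.aut) (i : I) (c d : C) (hd : d ∈ Δ.panel i c) :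
    col.localAction g i c (col.colour d i) = col.colour (g.1 d) i := by
  have h : (col.panelEquiv i c).symm (col.colour d i) = ⟨d, hd⟩ :=
    (Equiv.symm_apply_eq _).2 rfl
  simp only [localAction, Equiv.trans_apply, h]
  rfl

theorem localAction_ext {g : Δ.aut} {i : I} {c : C} {f : Equiv.Perm (X i)}
    (h : ∀ d ∈ Δ.panel i c, col.colour (g.1 d) i = f (col.colour d i)) :
    col.localAction g i c = f := by
  ext x
  obtain ⟨⟨d, hd⟩, rfl⟩ := (col.bijective_panel i c).2 x
  exact (col.localAction_colour g i c d hd).trans (h d hd)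

theorem localAction_one (i : I) (c : C) : col.localAction 1 i c = 1 :=
  col.localAction_ext fun _ _ => rfl

theorem localAction_mul (g h : Δ.aut) (i : I) (c : C) :
    col.localAction (g * h) i c = col.localAction g i (h.1 c) * col.localAction h i c := by
  refine col.localAction_ext fun d hd => ?_
  rw [Equiv.Perm.mul_apply, col.localAction_colour h i c d hd,
    col.localAction_colour g i (h.1 c) (h.1 d) ((h.2 i c d).2 hd)]
  rfl

theorem localAction_inv (g : Δ.aut) (i : I) (c : C) :
    col.localAction g⁻¹ i c = (col.localAction g i ((g⁻¹).1 c))⁻¹ := by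
  have h := col.localAction_mul g g⁻¹ i c
  rw [mul_inv_cancel, localAction_one] at h
  exact eq_inv_of_mul_eq_one_right h.symm

/-- The universal group `U(F)`: all automorphisms of `Δ` whose local action at every `i`-panel lies
in the local group `F i ≤ Sym(X i)`, for all `i`. -/
noncomputable def universalGroup (F : (i : I) → Subgroup (Equiv.Perm (X i))) :
    Subgroup Δ.aut where
  carrier := {g | ∀ i c, col.localAction g i c ∈ F i}
  mul_mem' := by
    intro g h hg hh i c
    rw [localAction_mul]
    exact (F i).mul_mem (hg i _) (hh i c)
  one_mem' := by
    intro i c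
    rw [localAction_one]
    exact (F i).one_mem
  inv_mem' := by
    intro g hg i c
    rw [localAction_inv]
    exact (F i).inv_mem (hg i _)

end LegalColouring

end ChamberSystem

/-- A Coxeter matrix is right-angled if `m i j ∈ {2, ∞}` for all `i ≠ j`. (In a Mathlib
`CoxeterMatrix`, the entry `0` stands for `∞`.) -/
def CoxeterMatrix.IsRightAngled {I : Type*} (M : CoxeterMatrix I) : Prop :=
  ∀ i j, i ≠ j → M i j = 2 ∨ M i j = 0

/-- The Coxeter diagram of `M` has no isolated nodes: every `i` is joined by an edge to some
`j ≠ i`, i.e. `m i j ≠ 2`. -/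
def CoxeterMatrix.HasNoIsolatedNodes {I : Type*} (M : CoxeterMatrix I) : Prop :=
  ∀ i, ∃ j, j ≠ i ∧ M i j ≠ 2

/-! Suppose `F i` has infinitely many orbits, and let `K` be a compact generating set. It moves a
chamber `c` to finitely many chambers, and galleries from `c` to these meet finitely many
`i`-colours, so some orbit `O` misses them all (`exists_finite_eqvGen`). The universal group
preserves the relation of being joined by a gallery with `i`-colours outside `O`, so the whole orbit
of `c` is related to `c`.

For a contradiction, choose `j` with `m_ij = ∞`. Changing the `i`- and `j`-colours alternately and
back leads from `c` to a chamber with the same colours, which lies in the orbit of `c`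
(`exists_mem_universalGroup`) but is not related to `c` (`exists_not_eqvGen`).

Both facts rest on `exists_equivariant`: the building is initial among coloured systems, since a
closed walk contracts by the word problem in right-angled Coxeter groups. Mapping the building to
itself gives automorphisms; mapping it to `voltageSystem` gives an integer invariant that only
entering or leaving `O` can change. -/

namespace CoxeterMatrix

/-! ### The word problem in right-angled Coxeter groups -/

variable {I : Type*} (M : CoxeterMatrix I)

open Classical in
/-- The simple reflection attached to `i` in (the contragredient of) the geometric representation
of a right-angled Coxeter group, in integral coordinates. -/
noncomputable def raReflection (i : I) : Function.End (I → ℤ) := fun v j =>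
  if j = i then -v i else if M i j = 0 then v j + 2 * v i else v j

theorem raReflection_same (i : I) (v : I → ℤ) : M.raReflection i v i = -v i := by
  simp [raReflection]

theorem raReflection_of_eq_zero {i j : I} (h : M i j = 0) (v : I → ℤ) :
    M.raReflection i v j = v j + 2 * v i := by
  have : j ≠ i := by
    rintro rfl
    simp at h
  simp [raReflection, this, h]

theorem raReflection_of_ne_zero {i j : I} (hj : j ≠ i) (h : M i j ≠ 0) (v : I → ℤ) :
    M.raReflection i v j = v j := by
  simp [raReflection, hj, h]

theorem raReflection_mul_self (i : I) : M.raReflection i * M.raReflection i = 1 := by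
  funext v j
  change M.raReflection i (M.raReflection i v) j = v j
  by_cases hj : j = i
  · subst hj
    simp [raReflection_same]
  · by_cases h : M i j = 0
    · simp [raReflection_of_eq_zero M h, raReflection_same]
    · simp [raReflection_of_ne_zero M hj h]

theorem raReflection_comm {i j : I} (h : M i j = 2) :
    M.raReflection i * M.raReflection j = M.raReflection j * M.raReflection i := by
  have hij : i ≠ j := by
    rintro rfl
    simp at h
  have h' : M j i = 2 := M.symmetric i j ▸ h
  funext v k
  change M.raReflection i (M.raReflection j v) k = M.raReflection j (M.raReflection i v) k
  simp only [raReflection]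
  split_ifs <;> simp_all
  ring

theorem isLiftable_raReflection (hM : M.IsRightAngled) : M.IsLiftable M.raReflection := by
  intro i j
  by_cases hij : i = j
  · subst hij
    simp [raReflection_mul_self]
  rcases hM i j hij with h | h
  · rw [h, pow_two, mul_assoc, ← mul_assoc (M.raReflection j), ← raReflection_comm M h,
      mul_assoc (M.raReflection i), raReflection_mul_self, mul_one, raReflection_mul_self]
  · rw [h, pow_zero]

/-- The image of the vector `(1, 1, …)` under an element of a right-angled Coxeter group. The
negative coordinates of this vector are the left descents. -/
noncomputable def raVector (hM : M.IsRightAngled) (w : M.Group) : I → ℤ :=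
  M.toCoxeterSystem.lift ⟨M.raReflection, M.isLiftable_raReflection hM⟩ w fun _ => 1

theorem raVector_one (hM : M.IsRightAngled) : M.raVector hM 1 = fun _ => 1 := by
  rw [raVector, map_one]
  rfl

theorem raVector_simple_mul (hM : M.IsRightAngled) (i : I) (w : M.Group) :
    M.raVector hM (M.toCoxeterSystem.simple i * w) = M.raReflection i (M.raVector hM w) := by
  rw [raVector, map_mul, CoxeterSystem.lift_apply_simple]
  rfl

theorem simple_mul_simple_comm {i j : I} (h : M i j = 2) :
    M.toCoxeterSystem.simple i * M.toCoxeterSystem.simple j =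
      M.toCoxeterSystem.simple j * M.toCoxeterSystem.simple i := by
  have := M.toCoxeterSystem.simple_mul_simple_pow i j
  rw [h, pow_two, mul_eq_one_iff_eq_inv, mul_inv_rev, CoxeterSystem.inv_simple,
    CoxeterSystem.inv_simple] at this
  exact this

theorem simple_mul_wordProd_comm {i : I} {β : List I} (h : ∀ b ∈ β, M i b = 2) :
    M.toCoxeterSystem.simple i * M.toCoxeterSystem.wordProd β =
      M.toCoxeterSystem.wordProd β * M.toCoxeterSystem.simple i := by
  induction β with
  | nil => simp
  | cons b β ih =>
    rw [CoxeterSystem.wordProd_cons, ← mul_assoc, simple_mul_simple_comm M (h b (by simp)),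
      mul_assoc, ih fun c hc => h c (by simp [hc]), mul_assoc]

theorem not_isReduced_of_cancel {i : I} {β γ : List I} (h : ∀ b ∈ β, M i b = 2) :
    ¬ M.toCoxeterSystem.IsReduced (i :: (β ++ i :: γ)) := by
  intro hr
  have h1 : M.toCoxeterSystem.wordProd (i :: (β ++ i :: γ)) =
      M.toCoxeterSystem.wordProd (β ++ γ) := by
    rw [CoxeterSystem.wordProd_cons, CoxeterSystem.wordProd_append, ← mul_assoc,
      simple_mul_wordProd_comm M h, CoxeterSystem.wordProd_cons, mul_assoc,
      CoxeterSystem.simple_mul_simple_cancel_left, CoxeterSystem.wordProd_append]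
  have h2 := M.toCoxeterSystem.length_wordProd_le (β ++ γ)
  rw [← h1, hr.eq] at h2
  simp at h2

/-- For a reduced word, a negative coordinate of the associated vector belongs to a letter that
can be commuted to the front. -/
theorem raVector_wordProd (hM : M.IsRightAngled) {ω : List I}
    (hω : M.toCoxeterSystem.IsReduced ω) :
    (∀ j, M.raVector hM (M.toCoxeterSystem.wordProd ω) j ≠ 0) ∧
    (∀ j k, M j k = 0 → 0 < M.raVector hM (M.toCoxeterSystem.wordProd ω) j +
      M.raVector hM (M.toCoxeterSystem.wordProd ω) k) ∧
    ∀ i, M.raVector hM (M.toCoxeterSystem.wordProd ω) i < 0 →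
      ∃ β γ, ω = β ++ i :: γ ∧ ∀ b ∈ β, M i b = 2 := by
  induction ω with
  | nil => simp [raVector_one]
  | cons i ω ih =>
    obtain ⟨h0, hadd, hneg⟩ := ih (hω.drop 1)
    -- Otherwise an `i` in `ω` commutes to the front and cancels the leading `i`.
    have hpos : 0 < M.raVector hM (M.toCoxeterSystem.wordProd ω) i := by
      by_contra! hle
      obtain ⟨β, γ, rfl, hβ⟩ := hneg i (lt_of_le_of_ne hle (h0 i))
      exact not_isReduced_of_cancel M hβ hω
    rw [CoxeterSystem.wordProd_cons, raVector_simple_mul]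
    set v := M.raVector hM (M.toCoxeterSystem.wordProd ω)
    have key : ∀ j, (j = i ∧ M.raReflection i v j = - v i) ∨
        (j ≠ i ∧ M i j = 0 ∧ M.raReflection i v j = v j + 2 * v i) ∨
        (j ≠ i ∧ M i j = 2 ∧ M.raReflection i v j = v j) := by
      intro j
      by_cases hj : j = i
      · subst hj
        exact Or.inl ⟨rfl, raReflection_same M j v⟩
      rcases hM i j (Ne.symm hj) with h | h
      · exact Or.inr (Or.inr ⟨hj, h, raReflection_of_ne_zero M hj (by omega) v⟩)
      · exact Or.inr (Or.inl ⟨hj, h, raReflection_of_eq_zero M h v⟩)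
    -- The sum condition keeps the induction going: if `m_ij = ∞`, the new coordinate `(v i + v j) +
    -- v i` is positive.
    refine ⟨fun j => ?_, fun j k hjk => ?_, fun j hj => ?_⟩
    · rcases key j with ⟨rfl, h⟩ | ⟨-, h1, h⟩ | ⟨-, -, h⟩
      · omega
      · have := hadd i j h1
        omega
      · rw [h]
        exact h0 j
    · have h1 := hadd j k hjk
      have h2 : M k j = 0 := M.symmetric j k ▸ hjk
      rcases key j with ⟨rfl, h⟩ | ⟨-, h3, h⟩ | ⟨-, h3, h⟩ <;>
      rcases key k with ⟨rfl, h'⟩ | ⟨-, h4, h'⟩ | ⟨-, h4, h'⟩ <;>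
      first
        | omega
        | simp at hjk
    · rcases key j with ⟨rfl, h⟩ | ⟨-, h1, h⟩ | ⟨-, h1, h⟩
      · exact ⟨[], ω, rfl, by simp⟩
      · have := hadd i j h1
        omega
      · obtain ⟨β, γ, rfl, hβ⟩ := hneg j (h ▸ hj)
        refine ⟨i :: β, γ, rfl, ?_⟩
        intro b hb
        rcases List.mem_cons.1 hb with rfl | hb
        · exact M.symmetric b j ▸ h1
        · exact hβ b hb

theorem raVector_pos_of_isReduced_cons (hM : M.IsRightAngled) {i : I} {ω : List I}
    (hω : M.toCoxeterSystem.IsReduced (i :: ω)) :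
    0 < M.raVector hM (M.toCoxeterSystem.wordProd ω) i := by
  obtain ⟨h0, -, hneg⟩ := M.raVector_wordProd hM (ω := ω) (hω.drop 1)
  by_contra! hle
  obtain ⟨β, γ, rfl, hβ⟩ := hneg i (lt_of_le_of_ne hle (h0 i))
  exact not_isReduced_of_cancel M hβ hω

/-- In a right-angled Coxeter group, a word that is not reduced has two equal letters such that
every letter in between commutes with them. -/
theorem exists_cancel_of_not_isReduced (hM : M.IsRightAngled) {ω : List I}
    (hω : ¬ M.toCoxeterSystem.IsReduced ω) :
    ∃ α i β γ, ω = α ++ i :: (β ++ i :: γ) ∧ ∀ b ∈ β, M i b = 2 := by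
  induction ω with
  | nil => simp [CoxeterSystem.IsReduced] at hω
  | cons i ω ih =>
    by_cases hr : M.toCoxeterSystem.IsReduced ω
    -- Prepending `i` shortens the element, so `i :: u` is another reduced word for it. Its `i`-th
    -- coordinate is therefore negative, and `ω` itself contains an `i` that commutes to the front.
    · obtain ⟨u, hu, hu'⟩ := M.toCoxeterSystem.exists_isReduced
        (M.toCoxeterSystem.simple i * M.toCoxeterSystem.wordProd ω)
      have hw : M.toCoxeterSystem.wordProd ω =
          M.toCoxeterSystem.simple i * M.toCoxeterSystem.wordProd u := by
        rw [← hu', CoxeterSystem.simple_mul_simple_cancel_left]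
      have hlen := M.toCoxeterSystem.length_simple_mul (M.toCoxeterSystem.wordProd ω) i
      rw [CoxeterSystem.IsReduced, CoxeterSystem.wordProd_cons, List.length_cons, ← hr.eq] at hω
      have hiu : M.toCoxeterSystem.IsReduced (i :: u) := by
        rw [CoxeterSystem.IsReduced, CoxeterSystem.wordProd_cons, ← hw, List.length_cons,
          ← hu.eq, ← hu']
        omega
      have hpos := M.raVector_pos_of_isReduced_cons hM hiu
      obtain ⟨β, γ, rfl, hβ⟩ := (M.raVector_wordProd hM hr).2.2 i (by
        rw [hw, raVector_simple_mul, raReflection_same]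
        omega)
      exact ⟨[], i, β, γ, rfl, hβ⟩
    · obtain ⟨α, j, β, γ, rfl, hβ⟩ := ih hr
      exact ⟨i :: α, j, β, γ, rfl, hβ⟩

theorem isReduced_pair (hM : M.IsRightAngled) {i j : I} (h : i ≠ j) :
    M.toCoxeterSystem.IsReduced [i, j] := by
  by_contra hr
  obtain ⟨α, k, β, γ, hω, -⟩ := M.exists_cancel_of_not_isReduced hM hr
  have hl := congrArg List.length hω
  simp only [List.length_cons, List.length_append, List.length_nil] at hl
  obtain rfl : α = [] := List.eq_nil_of_length_eq_zero (by omega)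
  obtain rfl : β = [] := List.eq_nil_of_length_eq_zero (by omega)
  simp at hω
  exact h (hω.1.trans hω.2.1.symm)

end CoxeterMatrix

/-! ### Coloured systems and their walks -/

/-- A system of states with colours, in which the colours can be changed one at a time, subject to
the relations that hold for the chambers of a legally coloured right-angled building. -/
structure ColouredSystem {I : Type*} [DecidableEq I] (M : CoxeterMatrix I) (X : I → Type*)
    (S : Type*) where
  colour : S → (i : I) → X i
  move : S → (Σ i, X i) → S
  colour_move : ∀ s l, colour (move s l) = Function.update (colour s) l.1 l.2
  move_self : ∀ s i, move s ⟨i, colour s i⟩ = s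
  move_move : ∀ s i x y, move (move s ⟨i, x⟩) ⟨i, y⟩ = move s ⟨i, y⟩
  move_comm : ∀ s i j x y, M i j = 2 →
    move (move s ⟨i, x⟩) ⟨j, y⟩ = move (move s ⟨j, y⟩) ⟨i, x⟩

namespace ColouredSystem

variable {I : Type*} [DecidableEq I] {M : CoxeterMatrix I} {X : I → Type*} {S T : Type*}
  (A : ColouredSystem M X S) (B : ColouredSystem M X T)

/-- Apply a sequence of moves. -/
def walk (s : S) (w : List (Σ i, X i)) : S := w.foldl A.move s

@[simp] theorem walk_nil (s : S) : A.walk s [] = s := rfl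

@[simp] theorem walk_cons (s : S) (l : Σ i, X i) (w : List (Σ i, X i)) :
    A.walk s (l :: w) = A.walk (A.move s l) w := rfl

theorem walk_append (s : S) (w w' : List (Σ i, X i)) :
    A.walk s (w ++ w') = A.walk (A.walk s w) w' := List.foldl_append

theorem colour_walk_eq {s : S} {t : T} (h : A.colour s = B.colour t) (w : List (Σ i, X i)) :
    A.colour (A.walk s w) = B.colour (B.walk t w) := by
  induction w generalizing s t with
  | nil => exact h
  | cons l w ih => exact ih (by rw [colour_move, colour_move, h])

theorem walk_comm (s : S) (i : I) (x : X i) (b : List (Σ i, X i)) (hb : ∀ l ∈ b, M i l.1 = 2) :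
    A.walk (A.move s ⟨i, x⟩) b = A.move (A.walk s b) ⟨i, x⟩ := by
  induction b generalizing s with
  | nil => rfl
  | cons l b ih =>
    rw [walk_cons, walk_cons, ← ih _ fun l hl => hb l (by simp [hl]),
      A.move_comm s i l.1 x l.2 (hb l (by simp))]

/-- The first `i`-move commutes past `b` and is then overwritten by the second. -/
theorem walk_cancel (s : S) (i : I) (x y : X i) (a b g : List (Σ i, X i))
    (hb : ∀ l ∈ b, M i l.1 = 2) :
    A.walk s (a ++ ⟨i, x⟩ :: (b ++ ⟨i, y⟩ :: g)) = A.walk s (a ++ (b ++ ⟨i, y⟩ :: g)) := by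
  simp only [walk_append, walk_cons]
  rw [walk_comm _ _ _ _ _ hb, move_move]

/-- Every sequence of moves can be reversed, by a sequence of moves depending only on the initial
colours. -/
theorem exists_reverse (s : S) (w : List (Σ i, X i)) : ∃ w' : List (Σ i, X i),
    (A.walk (A.walk s w) w' = s) ∧ ∀ t : T, B.colour t = A.colour s →
      (B.walk (B.walk t w) w' = t ∧
        ∀ t', B.colour t' = A.colour (A.walk s w) → B.walk t' (w' ++ w) = t') := by
  induction w generalizing s with
  | nil => exact ⟨[], rfl, fun t _ => ⟨rfl, fun _ _ => rfl⟩⟩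
  | cons l w ih =>
    obtain ⟨i, x⟩ := l
    obtain ⟨w', h1, h2⟩ := ih (A.move s ⟨i, x⟩)
    refine ⟨w' ++ [⟨i, A.colour s i⟩], ?_, fun t ht => ⟨?_, fun t' ht' => ?_⟩⟩
    · rw [walk_cons, walk_append, h1, walk_cons, walk_nil, move_move, move_self]
    · have := (h2 (B.move t ⟨i, x⟩) (by rw [colour_move, colour_move, ht])).1
      rw [walk_cons, walk_append, this, walk_cons, walk_nil, move_move, ← ht, move_self]
    · have h3 := (h2 (B.move t ⟨i, x⟩) (by rw [colour_move, colour_move, ht])).2 t' ht'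
      have h4 : B.colour (B.walk t' w') = A.colour (A.move s ⟨i, x⟩) := by
        rw [← h1]
        exact B.colour_walk_eq A ht' w'
      rw [List.append_assoc, walk_append, List.singleton_append, walk_cons, walk_cons, move_move]
      rw [walk_append] at h3
      have h5 := B.move_self (B.walk t' w') i
      rw [h4, colour_move, Function.update_self] at h5
      rw [h5, h3]

end ColouredSystem

/-! ### The building as the initial coloured system -/

namespace ChamberSystem.LegalColouring

variable {I C : Type*} {Δ : ChamberSystem I C} {X : I → Type*} (col : Δ.LegalColouring X)

/-- The chamber in the `i`-panel of `c` whose `i`-th colour is `x`. -/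
noncomputable def move (c : C) (i : I) (x : X i) : C := ((col.panelEquiv i c).symm x).1

theorem adj_move (c : C) (i : I) (x : X i) : (Δ.adj i).r c (col.move c i x) :=
  ((col.panelEquiv i c).symm x).2

theorem colour_move_same (c : C) (i : I) (x : X i) : col.colour (col.move c i x) i = x :=
  (col.panelEquiv i c).apply_symm_apply x

theorem colour_eq_of_adj {i j : I} (hj : j ≠ i) {c d : C} (h : (Δ.adj i).r c d) :
    col.colour d j = col.colour c j :=
  col.constant_panel i j hj c d h

theorem move_eq {c d : C} {i : I} {x : X i} (h : (Δ.adj i).r c d) (hx : col.colour d i = x) :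
    col.move c i x = d := by
  have : (col.panelEquiv i c).symm x = ⟨d, h⟩ := (Equiv.symm_apply_eq _).2 hx.symm
  exact congrArg Subtype.val this

/-- If neither move is trivial, they form a gallery of type `ij`. The reduced words `ij` and `ji`
represent the same element, so a gallery of type `ji` has the same ends, and the colours identify
its middle chamber. -/
theorem move_comm {M : CoxeterMatrix I} (hM : M.IsRightAngled) (hΔ : Δ.IsBuilding M)
    (c : C) (i j : I) (x : X i) (y : X j) (hij : M i j = 2) :
    col.move (col.move c i x) j y = col.move (col.move c j y) i x := by
  have hne : i ≠ j := by
    rintro rfl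
    simp at hij
  obtain ⟨-, -, δ, hδ⟩ := hΔ
  by_cases hx : col.colour c i = x
  · rw [col.move_eq ((Δ.adj i).refl c) hx]
    exact (col.move_eq ((Δ.adj i).refl _)
      ((col.colour_eq_of_adj hne (col.adj_move c j y)).trans hx)).symm
  by_cases hy : col.colour c j = y
  · rw [col.move_eq ((Δ.adj j).refl c) hy]
    exact col.move_eq ((Δ.adj j).refl _)
      ((col.colour_eq_of_adj hne.symm (col.adj_move c i x)).trans hy)
  set c1 := col.move c i x with hc1
  set c2 := col.move c1 j y with hc2
  have h1 : (Δ.adj i).r c c1 := col.adj_move c i x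
  have h2 : (Δ.adj j).r c1 c2 := col.adj_move c1 j y
  have e1 : col.colour c1 i = x := col.colour_move_same c i x
  have e2 : col.colour c2 j = y := col.colour_move_same c1 j y
  have e3 : col.colour c1 j = col.colour c j := col.colour_eq_of_adj hne.symm h1
  have e4 : col.colour c2 i = x := (col.colour_eq_of_adj hne h2).trans e1
  have hg : Δ.IsGallery [i, j] c c2 := by
    refine ⟨c1, ?_, h1, c2, ?_, h2, rfl⟩
    · intro h
      rw [h] at e1
      exact hx e1
    · intro h
      rw [h, e3] at e2
      exact hy e2
  rw [← hδ _ (M.isReduced_pair hM hne)] at hg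
  have hword : M.toCoxeterSystem.wordProd [i, j] = M.toCoxeterSystem.wordProd [j, i] := by
    simp only [CoxeterSystem.wordProd_cons, CoxeterSystem.wordProd_nil, mul_one]
    exact M.simple_mul_simple_comm hij
  rw [hword, hδ _ (M.isReduced_pair hM hne.symm)] at hg
  obtain ⟨z, -, h3, z', -, h4, rfl⟩ := hg
  have hz : col.move c j y = z :=
    col.move_eq h3 ((col.colour_eq_of_adj hne.symm h4).symm.trans e2)
  rw [hz]
  exact (col.move_eq h4 e4).symm

variable [DecidableEq I]

/-- The chambers of a legally coloured right-angled building form a coloured system. -/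
noncomputable def colouredSystem {M : CoxeterMatrix I} (hM : M.IsRightAngled)
    (hΔ : Δ.IsBuilding M) : ColouredSystem M X C where
  colour := col.colour
  move c l := col.move c l.1 l.2
  colour_move := by
    rintro c ⟨i, x⟩
    funext j
    by_cases h : j = i
    · subst h
      rw [Function.update_self, colour_move_same]
    · rw [Function.update_of_ne h, col.colour_eq_of_adj h (col.adj_move c i x)]
  move_self c i := col.move_eq ((Δ.adj i).refl c) rfl
  move_move c i x y := by
    refine (col.move_eq ?_ (col.colour_move_same _ i y)).symm
    exact (Δ.adj i).trans (col.adj_move c i x) (col.adj_move _ i y)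
  move_comm c i j x y h := col.move_comm hM hΔ c i j x y h

section

variable {M : CoxeterMatrix I} (hM : M.IsRightAngled) (hΔ : Δ.IsBuilding M)

theorem isGallery_or_exists_stutter (c : C) (w : List (Σ i, X i)) :
    Δ.IsGallery (w.map Sigma.fst) c ((col.colouredSystem hM hΔ).walk c w) ∨
      ∃ w₁ i x w₂, w = w₁ ++ ⟨i, x⟩ :: w₂ ∧
        (col.colouredSystem hM hΔ).colour ((col.colouredSystem hM hΔ).walk c w₁) i = x := by
  induction w generalizing c with
  | nil => exact Or.inl rfl
  | cons l w ih =>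
    obtain ⟨i, x⟩ := l
    by_cases hx : col.colour c i = x
    · exact Or.inr ⟨[], i, x, w, rfl, hx⟩
    rcases ih (col.move c i x) with h | ⟨w₁, j, y, w₂, rfl, h⟩
    · refine Or.inl ⟨col.move c i x, ?_, col.adj_move c i x, h⟩
      intro h'
      have := col.colour_move_same c i x
      rw [h'] at this
      exact hx this
    · exact Or.inr ⟨⟨i, x⟩ :: w₁, j, y, w₂, rfl, h⟩

/-- A closed sequence of moves on the chambers of a building is closed in every coloured system. -/
theorem walk_eq_self {S : Type*} (A : ColouredSystem M X S) (c : C) (s : S)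
    (hs : A.colour s = col.colour c) (w : List (Σ i, X i))
    (hw : (col.colouredSystem hM hΔ).walk c w = c) : A.walk s w = s := by
  induction hn : w.length using Nat.strong_induction_on generalizing w with
  | _ n ih =>
  subst hn
  -- A closed gallery of reduced type is empty, as its distance is `1`. In the other cases a
  -- cancelling letter or a trivial move can be dropped, in both systems at once because triviality
  -- depends only on colours.
  rcases col.isGallery_or_exists_stutter hM hΔ c w with hg | ⟨w₁, i, x, w₂, rfl, hx⟩
  · rw [hw] at hg
    by_cases hr : M.toCoxeterSystem.IsReduced (w.map Sigma.fst)
    · obtain ⟨-, -, δ, hδ⟩ := hΔ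
      have h1 := (hδ _ hr c c).2 hg
      have h2 := (hδ [] (by simp [CoxeterSystem.IsReduced]) c c).2 rfl
      rw [h2, CoxeterSystem.wordProd_nil] at h1
      have h3 := hr.eq
      rw [← h1, CoxeterSystem.length_one, List.length_map] at h3
      rw [List.eq_nil_of_length_eq_zero h3.symm, ColouredSystem.walk_nil]
    · obtain ⟨α, i, β, γ, hω, hβ⟩ := M.exists_cancel_of_not_isReduced hM hr
      obtain ⟨a, r, rfl, -, h1⟩ := List.map_eq_append_iff.1 hω
      obtain ⟨⟨_, x⟩, r, rfl, rfl, h2⟩ := List.map_eq_cons_iff.1 h1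
      obtain ⟨b, r, rfl, rfl, h3⟩ := List.map_eq_append_iff.1 h2
      obtain ⟨⟨_, y⟩, g, rfl, rfl, -⟩ := List.map_eq_cons_iff.1 h3
      have hb : ∀ l ∈ b, M _ l.1 = 2 := fun l hl => hβ l.1 (List.mem_map_of_mem hl)
      rw [ColouredSystem.walk_cancel _ _ _ _ _ _ _ _ hb] at hw ⊢
      exact ih _ (by simp) _ hw rfl
  · have hx' : A.colour (A.walk s w₁) i = x := by
      rw [A.colour_walk_eq (col.colouredSystem hM hΔ) hs, hx]
    subst hx
    have h := ih _ (by simp) (w₁ ++ w₂) (by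
      rwa [ColouredSystem.walk_append, ColouredSystem.walk_cons, ColouredSystem.move_self,
        ← ColouredSystem.walk_append] at hw) rfl
    rwa [ColouredSystem.walk_append, ColouredSystem.walk_cons, ← hx', ColouredSystem.move_self,
        ← ColouredSystem.walk_append]

theorem walk_eq_walk {S : Type*} (A : ColouredSystem M X S) (c : C) (s : S)
    (hs : A.colour s = col.colour c) (w w' : List (Σ i, X i))
    (hw : (col.colouredSystem hM hΔ).walk c w = (col.colouredSystem hM hΔ).walk c w') :
    A.walk s w = A.walk s w' := by
  obtain ⟨r, h1, h2⟩ := (col.colouredSystem hM hΔ).exists_reverse A c w'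
  have h3 := col.walk_eq_self hM hΔ A c s hs (w ++ r) (by
    rw [ColouredSystem.walk_append, hw, h1])
  have h4 := (h2 s hs).2 (A.walk s w) (by
    rw [A.colour_walk_eq (col.colouredSystem hM hΔ) hs, hw])
  rw [ColouredSystem.walk_append] at h3 h4
  rw [← h4, h3]

theorem exists_walk_of_isGallery (ω : List I) (c d : C) (h : Δ.IsGallery ω c d) :
    ∃ w, (col.colouredSystem hM hΔ).walk c w = d := by
  induction ω generalizing c with
  | nil => exact ⟨[], h⟩
  | cons i ω ih =>
    obtain ⟨z, -, hz, h⟩ := h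
    obtain ⟨w, hw⟩ := ih z h
    refine ⟨⟨i, col.colour z i⟩ :: w, ?_⟩
    rw [ColouredSystem.walk_cons, ← hw]
    congr 1
    exact col.move_eq hz rfl

theorem exists_walk (c d : C) : ∃ w, (col.colouredSystem hM hΔ).walk c w = d := by
  obtain ⟨δ, hδ⟩ := hΔ.2.2
  obtain ⟨ω, hω, h⟩ := M.toCoxeterSystem.exists_isReduced (δ c d)
  exact col.exists_walk_of_isGallery hM hΔ ω c d ((hδ ω hω c d).1 h)

/-- The universal property of a legally coloured right-angled building among coloured systems. -/
theorem exists_equivariant {M : CoxeterMatrix I} (hM : M.IsRightAngled)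
    (hΔ : Δ.IsBuilding M) {S : Type*} (A : ColouredSystem M X S) (c : C) (s : S)
    (hs : A.colour s = col.colour c) : ∃ ψ : C → S, ψ c = s ∧
      (∀ d, A.colour (ψ d) = col.colour d) ∧
      ∀ d i x, ψ (col.move d i x) = A.move (ψ d) ⟨i, x⟩ := by
  choose w hw using col.exists_walk hM hΔ c
  refine ⟨fun d => A.walk s (w d), ?_, fun d => ?_, fun d i x => ?_⟩
  · exact col.walk_eq_self hM hΔ A c s hs _ (hw c)
  · rw [A.colour_walk_eq (col.colouredSystem hM hΔ) hs, hw]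
    rfl
  · change A.walk s (w (col.move d i x)) = A.move (A.walk s (w d)) ⟨i, x⟩
    have h : A.walk s (w (col.move d i x)) = A.walk s (w d ++ [⟨i, x⟩]) := by
      refine col.walk_eq_walk hM hΔ A c s hs _ _ ?_
      rw [hw, ColouredSystem.walk_append, hw]
      rfl
    rw [h, ColouredSystem.walk_append]
    rfl

end

end ChamberSystem.LegalColouring

/-! ### Colour-preserving automorphisms -/

namespace ChamberSystem.LegalColouring

variable {I C : Type*} {Δ : ChamberSystem I C} {X : I → Type*} (col : Δ.LegalColouring X)

theorem eq_of_equivariant {M : CoxeterMatrix I} (hM : M.IsRightAngled) (hΔ : Δ.IsBuilding M)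
    {c : C} {f : C → C} (hc : f c = c) (hf : ∀ d i x, f (col.move d i x) = col.move (f d) i x)
    (d : C) : f d = d := by
  classical
  obtain ⟨w, rfl⟩ := col.exists_walk hM hΔ c d
  induction w generalizing c with
  | nil => exact hc
  | cons l w ih =>
    refine ih (c := col.move c l.1 l.2) ?_
    rw [hf, hc]

/-- Two chambers with the same colours lie in the same orbit of the universal group. -/
theorem exists_mem_universalGroup {M : CoxeterMatrix I} (hM : M.IsRightAngled)
    (hΔ : Δ.IsBuilding M) (F : (i : I) → Subgroup (Equiv.Perm (X i))) {c d : C}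
    (h : col.colour c = col.colour d) : ∃ g ∈ col.universalGroup F, g.1 c = d := by
  classical
  obtain ⟨ψ, hψ, hψc, hψm⟩ := col.exists_equivariant hM hΔ (col.colouredSystem hM hΔ) c d h.symm
  obtain ⟨φ, hφ, -, hφm⟩ := col.exists_equivariant hM hΔ (col.colouredSystem hM hΔ) d c h
  change ∀ d, col.colour (ψ d) = col.colour d at hψc
  change ∀ d i x, ψ (col.move d i x) = col.move (ψ d) i x at hψm
  change ∀ d i x, φ (col.move d i x) = col.move (φ d) i x at hφm
  have h1 : ∀ e, φ (ψ e) = e := col.eq_of_equivariant hM hΔ (c := c) (f := fun e => φ (ψ e))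
    (by simp only [hψ, hφ]) (by simp [hψm, hφm])
  have h2 : ∀ e, ψ (φ e) = e := col.eq_of_equivariant hM hΔ (c := d) (f := fun e => ψ (φ e))
    (by simp only [hψ, hφ]) (by simp [hψm, hφm])
  have key : ∀ f : C → C, (∀ d i x, f (col.move d i x) = col.move (f d) i x) →
      ∀ i e e', (Δ.adj i).r e e' → (Δ.adj i).r (f e) (f e') := by
    intro f hf i e e' he
    rw [← col.move_eq he rfl, hf]
    exact col.adj_move _ _ _
  refine ⟨⟨⟨ψ, φ, h1, h2⟩, fun i e e' => ⟨fun he => ?_, key ψ hψm i e e'⟩⟩, ?_, hψ⟩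
  · have := key φ hφm i _ _ he
    change (Δ.adj i).r (φ (ψ e)) (φ (ψ e')) at this
    rwa [h1, h1] at this
  -- The automorphism preserves all colours, so its local actions are trivial and lie in any `F i`.
  · intro i e
    rw [col.localAction_ext (f := 1) fun e' _ => congrFun (hψc e') i]
    exact (F i).one_mem

/-! ### Galleries avoiding a set of colours -/

open Classical in
/-- The indicator function of the colourings with `i`-th colour in `O` and `j`-th colour `y`. -/
noncomputable def indicatorColour {i j : I} (O : Set (X i)) (y : X j) (κ : (i : I) → X i) : ℤ :=
  if κ i ∈ O ∧ κ j = y then 1 else 0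

theorem indicatorColour_update [DecidableEq I] {i j k : I} (O : Set (X i)) (y : X j)
    (κ : (i : I) → X i) (hi : k ≠ i) (hj : k ≠ j) (x : X k) :
    indicatorColour O y (Function.update κ k x) = indicatorColour O y κ := by
  have h1 : Function.update κ k x i = κ i := Function.update_of_ne hi.symm _ _
  have h2 : Function.update κ k x j = κ j := Function.update_of_ne hj.symm _ _
  unfold indicatorColour
  classical
  exact if_congr (by rw [h1, h2]) rfl rfl

/-- The coloured system that records in an integer, for an edge `{i, j}` of the Coxeter diagram, the
variation of `indicatorColour O y` along the changes of the `i`-th colour. -/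
noncomputable def voltageSystem [DecidableEq I] (M : CoxeterMatrix I) {i j : I}
    (hij : M i j = 0) (O : Set (X i)) (y : X j) :
    ColouredSystem M X (((i : I) → X i) × ℤ) where
  colour s := s.1
  move s l := (Function.update s.1 l.1 l.2, if l.1 = i then
    s.2 + indicatorColour O y (Function.update s.1 l.1 l.2) - indicatorColour O y s.1 else s.2)
  colour_move _ _ := rfl
  move_self s i := by simp
  move_move s k x y' := by
    by_cases hk : k = i
    · simp [hk]
      ring
    · simp [hk]
  move_comm := by
    rintro ⟨κ, n⟩ k l x z hkl
    have hne : k ≠ l := by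
      rintro rfl
      simp at hkl
    refine Prod.ext (Function.update_comm hne _ _ _) ?_
    -- A letter commuting with `i` is not `j`, so its move does not affect the indicator.
    by_cases hk : k = i
    · have hl : l ≠ j := by
        rintro rfl
        rw [hk, hij] at hkl
        simp at hkl
      have hli : l ≠ i := fun h => hne (hk.trans h.symm)
      simp only [hk, hli, if_true, if_false]
      subst hk
      rw [Function.update_comm hne.symm, indicatorColour_update O y _ hli hl,
        indicatorColour_update O y _ hli hl]
    · by_cases hl : l = i
      · have hkj : k ≠ j := by
          rintro rfl
          rw [hl, M.symmetric, hij] at hkl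
          simp at hkl
        simp only [hk, hl, if_true, if_false]
        subst hl
        rw [Function.update_comm hne, indicatorColour_update O y _ hk hkj,
          indicatorColour_update O y _ hk hkj]
      · simp [hk, hl]

/-- Adjacency of chambers whose `i`-th colours lie outside `O`. -/
def AdjOutside (i : I) (O : Set (X i)) (c d : C) : Prop :=
  col.colour c i ∉ O ∧ col.colour d i ∉ O ∧ ∃ k, (Δ.adj k).r c d

/-- `Y` collects the `i`-colours along one walk from `c` to `d`. -/
theorem exists_finite_eqvGen {M : CoxeterMatrix I} (hM : M.IsRightAngled) (hΔ : Δ.IsBuilding M)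
    (i : I) (c d : C) : ∃ Y : Set (X i), Y.Finite ∧ col.colour c i ∈ Y ∧
      ∀ O : Set (X i), Disjoint Y O → Relation.EqvGen (col.AdjOutside i O) c d := by
  classical
  obtain ⟨w, rfl⟩ := col.exists_walk hM hΔ c d
  induction w generalizing c with
  | nil => exact ⟨{col.colour c i}, Set.finite_singleton _, rfl, fun O _ => .refl _⟩
  | cons l w ih =>
    obtain ⟨Y, hY, hc, h⟩ := ih (col.move c l.1 l.2)
    refine ⟨insert (col.colour c i) Y, hY.insert _, Set.mem_insert _ _, fun O hO => ?_⟩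
    have hO' := Set.disjoint_left.1 hO
    exact .trans _ _ _ (.rel _ _ ⟨hO' (Set.mem_insert _ _), hO' (Set.mem_insert_of_mem _ hc),
      l.1, col.adj_move c l.1 l.2⟩) (h O (hO.mono_left (Set.subset_insert _ _)))

/-- Some chamber with the same colours as `c` cannot be reached from `c` by a gallery all of whose
chambers have their `i`-th colour outside `O`. -/
theorem exists_not_eqvGen {M : CoxeterMatrix I} (hM : M.IsRightAngled) (hΔ : Δ.IsBuilding M)
    {i j : I} (hij : M i j = 0) (c : C) {O : Set (X i)} (hO : O.Nonempty)
    (hc : col.colour c i ∉ O) :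
    ∃ d, col.colour c = col.colour d ∧ ¬ Relation.EqvGen (col.AdjOutside i O) c d := by
  classical
  have hne : j ≠ i := by
    rintro rfl
    simp at hij
  obtain ⟨x, hx⟩ := hO
  obtain ⟨e, he, hec⟩ := hΔ.2.1 j c
  have hy : col.colour c j ≠ col.colour e j := by
    intro h
    apply hec
    rw [← col.move_eq he rfl, ← h, col.move_eq ((Δ.adj j).refl c) rfl]
  set y := col.colour e j
  set A := voltageSystem (X := X) M hij O y
  obtain ⟨ψ, hψ, hψc, hψm⟩ := col.exists_equivariant hM hΔ A c (col.colour c, 0) rfl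
  have hconst : ∀ d d', Relation.EqvGen (col.AdjOutside i O) d d' → (ψ d).2 = (ψ d').2 := by
    intro d d' h
    induction h with
    | rel d d' h =>
      obtain ⟨h1, h2, k, hk⟩ := h
      have h3 := hψm d k (col.colour d' k)
      rw [col.move_eq hk rfl] at h3
      have h4 : (ψ d').1 = Function.update (ψ d).1 k (col.colour d' k) := congrArg Prod.fst h3
      have h5 : (ψ d').2 = if k = i then (ψ d).2 + indicatorColour O y
        (Function.update (ψ d).1 k (col.colour d' k)) - indicatorColour O y (ψ d).1
        else (ψ d).2 := congrArg Prod.snd h3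
      have h6 : (ψ d).1 = col.colour d := hψc d
      have h7 : (ψ d').1 = col.colour d' := hψc d'
      rw [h5, ← h4, h6, h7]
      simp [indicatorColour, h1, h2]
    | refl => rfl
    | symm _ _ _ ih => exact ih.symm
    | trans _ _ _ _ _ ih ih' => exact ih.trans ih'
  -- Of these four moves only the third changes the integer: it leaves `O` while the `j`-colour is
  -- `y`, contributing `-1`. The first enters `O` with `j`-colour different from `y`.
  refine ⟨col.move (col.move (col.move (col.move c i x) j y) i (col.colour c i)) j
    (col.colour c j), ?_, fun h => ?_⟩
  · refine Eq.trans ?_ (hψc _)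
    rw [hψm, hψm, hψm, hψm, hψ]
    change _ = Function.update (Function.update (Function.update (Function.update
      (col.colour c) i x) j y) i (col.colour c i)) j (col.colour c j)
    rw [Function.update_comm hne, Function.update_idem, Function.update_idem,
      Function.update_eq_self, Function.update_eq_self]
  · have h1 := hconst _ _ h
    rw [hψm, hψm, hψm, hψm, hψ] at h1
    simp [A, voltageSystem, hne, hne.symm, indicatorColour, hx, hc, hy] at h1

theorem adjOutside_map {F : (i : I) → Subgroup (Equiv.Perm (X i))} {i : I} {O : Set (X i)}
    (hO : ∀ f ∈ F i, ∀ x, f x ∈ O ↔ x ∈ O) {g : Δ.aut} (hg : g ∈ col.universalGroup F) {c d : C}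
    (h : Relation.EqvGen (col.AdjOutside i O) c d) :
    Relation.EqvGen (col.AdjOutside i O) (g.1 c) (g.1 d) := by
  have hcol : ∀ c, col.colour (g.1 c) i ∈ O ↔ col.colour c i ∈ O := by
    intro c
    rw [← col.localAction_colour g i c c ((Δ.adj i).refl c)]
    exact hO _ (hg i c) _
  induction h with
  | rel c d h =>
    obtain ⟨h1, h2, k, hk⟩ := h
    exact .rel _ _ ⟨mt (hcol c).1 h1, mt (hcol d).1 h2, k, (g.2 k c d).2 hk⟩
  | refl => exact .refl _
  | symm _ _ _ ih => exact .symm _ _ ih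
  | trans _ _ _ _ _ ih ih' => exact .trans _ _ _ ih ih'

end ChamberSystem.LegalColouring

/-! ### Compactness and the conclusion -/

theorem isOpen_setOf_perm_apply_eq {X : Type*} (x y : X) :
    IsOpen {g : Equiv.Perm X | g x = y} := by
  intro g hg
  refine ⟨{x}, fun h hh => ?_⟩
  change g (h x) = y
  rw [hh x (Finset.mem_singleton_self x)]
  exact hg

/-- A compact set of permutations moves a point to finitely many points only. -/
theorem IsCompact.finite_image_perm {G X : Type*} [TopologicalSpace G] {φ : G → Equiv.Perm X}
    (hφ : Continuous φ) {K : Set G} (hK : IsCompact K) (x : X) :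
    ((fun g => φ g x) '' K).Finite := by
  let _ : TopologicalSpace X := ⊥
  have : DiscreteTopology X := ⟨rfl⟩
  have hc : Continuous fun g => φ g x :=
    continuous_discrete_rng.2 fun y => (isOpen_setOf_perm_apply_eq x y).preimage hφ
  exact (hK.image hc).finite_of_discrete

theorem mainTheorem5 {I C : Type*} [Finite I] (M : CoxeterMatrix I)
    (hM : M.IsRightAngled) (hiso : M.HasNoIsolatedNodes)
    (Δ : ChamberSystem I C) (hΔ : Δ.IsBuilding M)
    {X : I → Type*} (col : Δ.LegalColouring X)
    (F : (i : I) → Subgroup (Equiv.Perm (X i)))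
    (hclosed : IsClosed (col.universalGroup F : Set Δ.aut))
    (hlc : LocallyCompactSpace (col.universalGroup F))
    (hcg : IsCompactlyGeneratedGroup (col.universalGroup F)) :
    ∀ i, Finite (MulAction.orbitRel.Quotient (F i) (X i)) := by
  intro i
  obtain ⟨j, hji, hj⟩ := hiso i
  have hij : M i j = 0 := (hM i j hji.symm).resolve_left hj
  obtain ⟨K, hK, hgen⟩ := hcg
  obtain ⟨c⟩ := hΔ.1
  choose Y hY hYc hYO using col.exists_finite_eqvGen hM hΔ i c
  have hfin : ((fun g : col.universalGroup F => g.1.1 c) '' K).Finite :=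
    hK.finite_image_perm (continuous_subtype_val.comp continuous_subtype_val) c
  -- `Y c` is included so that the colour of `c` itself lies outside `O`.
  set Z : Set (X i) := Y c ∪ ⋃ d ∈ (fun g : col.universalGroup F => g.1.1 c) '' K, Y d
  have hZ : Z.Finite := (hY c).union (hfin.biUnion fun d _ => hY d)
  by_contra hinf
  rw [not_finite_iff_infinite] at hinf
  obtain ⟨q, hq⟩ := (hZ.image (Quotient.mk (MulAction.orbitRel (F i) (X i)))).exists_notMem
  set O : Set (X i) := {x | Quotient.mk (MulAction.orbitRel (F i) (X i)) x = q}
  have hZO : Disjoint Z O :=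
    Set.disjoint_left.2 fun x hx hxO => hq ⟨x, hx, hxO⟩
  have hO : ∀ f ∈ F i, ∀ x, f x ∈ O ↔ x ∈ O := by
    intro f hf x
    have : Quotient.mk (MulAction.orbitRel (F i) (X i)) (f x) = Quotient.mk _ x :=
      Quotient.sound ⟨⟨f, hf⟩, rfl⟩
    change _ = q ↔ _ = q
    rw [this]
  have hconn : ∀ g : col.universalGroup F,
      Relation.EqvGen (col.AdjOutside i O) c (g.1.1 c) := by
    intro g
    have hg : g ∈ Subgroup.closure K := hgen ▸ Subgroup.mem_top g
    induction hg using Subgroup.closure_induction with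
    | mem g hg =>
      refine hYO _ O (hZO.mono_left fun x hx => Or.inr ?_)
      exact Set.mem_biUnion ⟨g, hg, rfl⟩ hx
    | one => exact .refl _
    -- Join `c` to `g c`, then follow the `g`-translate of the connection from `c` to `h c`.
    | mul g h _ _ ihg ihh => exact .trans _ _ _ ihg (col.adjOutside_map hO g.2 ihh)
    | inv g _ ih =>
      have := col.adjOutside_map hO (g⁻¹).2 ih
      refine .symm _ _ ?_
      convert this using 1
      exact (Equiv.symm_apply_apply g.1.1 c).symm
  obtain ⟨d, hd, hnot⟩ := col.exists_not_eqvGen hM hΔ hij c (O := O) (Quotient.exists_rep q)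
    (Set.disjoint_left.1 hZO (Or.inl (hYc c)))
  obtain ⟨g, hg, rfl⟩ := col.exists_mem_universalGroup hM hΔ F hd
  exact hnot (hconn ⟨g, hg⟩)
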